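/- Let $d\in\mathbb N$, $L>0$, and let $\mathbb T=(\mathbb R/L\mathbb Z)^d$ carry Lebesgue measure of total mass $L^d$. Let $V:\mathbb T\to\mathbb R$ satisfy: $V\in L^1(\mathbb T)\cap L^2(\mathbb T)$, the negative part of $V$ is essentially bounded, $V(-x)=V(x)$, $V(x)=0$ whenever $|x|>a$ for some $a<L$ (with $|x|$ the flat distance from $x$ to $0$), and $V$ is not of positive type, i.e. it is not the case that $\iint V(x-y)h(x)h(y)\,dx\,dy\ge 0$ for every real $h\in L^1(\mathbb T)$ for which the integral is defined. Let $\mathscr P$ be the set of probability densities on $\mathbb T$, let $\rho_0\equiv L^{-d}$, and for $\theta\ge 0$ and $\rho\in\mathscr P$ put $$\mathcal F_\theta(\rho)=\int_{\mathbb T}\rho\log\rho\,dx+\tfrac12\,\theta L^d\iint_{\mathbb T\times\mathbb T}V(x-y)\rho(x)\rho(y)\,dx\,dy,$$ with $\mathcal F_\theta(\rho)=+\infty$ if one of the two integrands is not integrable. Minimizers of $\mathcal F_\theta$ are taken over $\mathscr P$, and densities are identified when equal almost everywhere. Suppose that $\theta_c\ge 0$ is a (lower) critical point, that is: 1. for $0\le\theta\le\theta_c$,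 $\rho_0$ is the unique minimizer of $\mathcal F_\theta$; 2. for every $\theta>\theta_c$ there is a minimizer $\rho_\theta\ne\rho_0$ of $\mathcal F_\theta$; 3. for every family $(\rho_\theta)_{\theta>\theta_c}$ of such minimizers, $\|\rho_\theta-\rho_0\|_{L^1}\to 0$ as $\theta\downarrow\theta_c$. For a wave vector $k\in\frac{2\pi}{L}\mathbb Z^d$ let $\hat V(k)=\int_{\mathbb T}V(x)e^{-ik\cdot x}\,dx$, which is real. Then $\hat V$ has a minimum over the non-zero wave vectors, attained at some $k^\sharp\neq 0$, one has $\hat V(k^\sharp)<0$, and $$\theta_c=\theta^\sharp:=|\hat V(k^\sharp)|^{-1}.$$ -/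

import Mathlib

open MeasureTheory Filter Topology

noncomputable section

namespace McKeanVlasov

/-- The `d`-dimensional torus of scale `L`, i.e. `(ℝ / Lℤ)^d`. Its `volume` is the product of the
Lebesgue measures of total mass `L` on the factors. -/
abbrev Torus (d : ℕ) (L : ℝ) : Type := Fin d → AddCircle L

/-- The Euclidean (flat) distance of a point of the torus to the origin. The norm of
`x i : AddCircle L` is the distance of `x i` to `0` in `ℝ / Lℤ`. -/
def euclLength {d : ℕ} {L : ℝ} (x : Torus d L) : ℝ := Real.sqrt (∑ i, ‖x i‖ ^ 2)

variable {d : ℕ} {L : ℝ} [Fact (0 < L)]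

/-- The class `𝒱` of potentials: integrable, with bounded negative part, symmetric,
and of finite range `a < L`. -/
structure IsPotential (V : Torus d L → ℝ) : Prop where
  integrable : Integrable V volume
  bounded_negPart : MemLp (fun x => max (-V x) 0) ⊤ volume
  symmetric : ∀ᵐ x ∂(volume : Measure (Torus d L)), V (-x) = V x
  finite_range : ∃ a : ℝ, a < L ∧
    ∀ᵐ x ∂(volume : Measure (Torus d L)), a < euclLength x → V x = 0

/-- `V` is of positive type: `∬ V(x-y) h(x) h(y) dx dy ≥ 0` for every `h ∈ L¹`
for which the double integral makes sense. -/
def PositiveType (V : Torus d L → ℝ) : Prop :=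
  ∀ h : Torus d L → ℝ, Integrable h volume →
    Integrable (fun p : Torus d L × Torus d L => V (p.1 - p.2) * h p.1 * h p.2) volume →
    0 ≤ ∫ p : Torus d L × Torus d L, V (p.1 - p.2) * h p.1 * h p.2

/-- The class `𝒱_N = 𝒱 \ 𝒱⁺` of potentials that are not of positive type. -/
def IsPotentialN (V : Torus d L → ℝ) : Prop := IsPotential V ∧ ¬ PositiveType V

/-- The class `𝒫` of probability densities on the torus. -/
structure IsDensity (ρ : Torus d L → ℝ) : Prop where
  integrable : Integrable ρ volume
  nonneg : ∀ᵐ x ∂(volume : Measure (Torus d L)), 0 ≤ ρ x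
  integral_eq_one : ∫ x, ρ x = 1

variable (d L) in
/-- The uniform density `ρ₀ = L^{-d}`. -/
def uniformDensity : Torus d L → ℝ := fun _ => (L ^ d)⁻¹

/-- The entropy term `𝒮(ρ) = ∫ ρ log ρ`. -/
def entropy (ρ : Torus d L → ℝ) : ℝ := ∫ x, ρ x * Real.log (ρ x)

/-- The energy term `ℰ(ρ_a, ρ_b) = ∬ V(x-y) ρ_a(x) ρ_b(y) dx dy`. -/
def energy (V ρa ρb : Torus d L → ℝ) : ℝ :=
  ∫ p : Torus d L × Torus d L, V (p.1 - p.2) * ρa p.1 * ρb p.2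

open Classical in
/-- The free energy `ℱ_θ(ρ) = 𝒮(ρ) + (θ/2) L^d ℰ(ρ, ρ)`. For `V ∈ 𝒱` and a density `ρ` the negative
parts of both integrands are integrable, so the value is `+∞` when an integrand is not integrable. -/
def freeEnergy (V : Torus d L → ℝ) (θ : ℝ) (ρ : Torus d L → ℝ) : EReal :=
  if Integrable (fun x => ρ x * Real.log (ρ x)) volume ∧
      Integrable (fun p : Torus d L × Torus d L => V (p.1 - p.2) * ρ p.1 * ρ p.2) volume
  then ((entropy ρ + 1 / 2 * θ * L ^ d * energy V ρ ρ : ℝ) : EReal)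
  else ⊤

/-- `ρ` minimizes `ℱ_θ` over the class of probability densities. -/
def IsMinimizer (V : Torus d L → ℝ) (θ : ℝ) (ρ : Torus d L → ℝ) : Prop :=
  IsDensity ρ ∧ ∀ ρ' : Torus d L → ℝ, IsDensity ρ' → freeEnergy V θ ρ ≤ freeEnergy V θ ρ'

/-- A minimizer of `ℱ_θ` that is not (a.e. equal to) the uniform density. -/
def IsNontrivialMinimizer (V : Torus d L → ℝ) (θ : ℝ) (ρ : Torus d L → ℝ) : Prop :=
  IsMinimizer V θ ρ ∧ ¬ ρ =ᵐ[volume] uniformDensity d L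

/-- `θc` is a (lower) critical point. The interaction parameter `θ` ranges over `[0, ∞)`. -/
structure IsLowerCriticalPoint (V : Torus d L → ℝ) (θc : ℝ) : Prop where
  nonneg : 0 ≤ θc
  /-- for `θ ≤ θc` the uniform density is the unique minimizer -/
  unique_below : ∀ θ : ℝ, 0 ≤ θ → θ ≤ θc →
    IsMinimizer V θ (uniformDensity d L) ∧
      ∀ ρ : Torus d L → ℝ, IsMinimizer V θ ρ → ρ =ᵐ[volume] uniformDensity d L
  /-- for `θ > θc` there is a non-trivial minimizer -/
  exists_above : ∀ θ : ℝ, θc < θ → ∃ ρ : Torus d L → ℝ, IsNontrivialMinimizer V θ ρ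
  /-- every family of non-trivial minimizers converges to the uniform density in `L¹` -/
  tendsto_uniform : ∀ ρ : ℝ → Torus d L → ℝ,
    (∀ θ : ℝ, θc < θ → IsNontrivialMinimizer V θ (ρ θ)) →
      Tendsto (fun θ : ℝ => ∫ x, |uniformDensity d L x - ρ θ x|) (𝓝[>] θc) (𝓝 0)

/-- The Fourier transform `V̂(k) = ∫ V(x) e^{-i k·x} dx` at the wave vector `k = 2πn/L`, `n ∈ ℤ^d`.
It is real when `V` is symmetric. -/
def fourierTransform (V : Torus d L → ℝ) (n : Fin d → ℤ) : ℂ :=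
  ∫ x : Torus d L, (V x : ℂ) * ∏ i, fourier (-(n i)) (x i)

/-- `n` indexes a minimizing wave vector of `V̂` among the non-zero wave vectors
(the zero mode is fixed by the normalization of densities). -/
def IsMinimizingWaveVector (V : Torus d L → ℝ) (n : Fin d → ℤ) : Prop :=
  n ≠ 0 ∧ ∀ m : Fin d → ℤ, m ≠ 0 → (fourierTransform V n).re ≤ (fourierTransform V m).re

/-- `θ` is the value `θ♯ = |V̂(k♯)|⁻¹`, where `k♯` is a minimizing wave vector and `V̂(k♯) < 0`. -/
def IsThetaSharp (V : Torus d L → ℝ) (θ : ℝ) : Prop :=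
  ∃ n : Fin d → ℤ, IsMinimizingWaveVector V n ∧ (fourierTransform V n).re < 0 ∧
    θ = ‖fourierTransform V n‖⁻¹

end McKeanVlasov

end

/-! Write a density as L^{-d}(1 + t), with t ≥ -1 of mean zero. The cross terms of the energy
vanish, so the free energy exceeds that of the uniform density by L^{-d}(∫ `entropyGap` t + (θ/2)
E(t,t)), see `freeEnergy_perturbed`. To second order this is a quadratic form, diagonal in Fourier
modes with weights proportional to 1 + θ V̂(k). With -λ the minimum of V̂ over nonzero modes, it
degenerates at θλ = 1.

The bound θc λ ≤ 1 is linear stability of the minimizer at θc, tested with a small cosine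
(`stability_of_isMinimizer`).

For θc λ ≥ 1 (`one_le_mul_of_isLowerCriticalPoint`), suppose θc λ < 1. Just above θc there are
nontrivial minimizers that are close to uniform, but only in L¹, so t may be large and no Taylor
expansion applies. `ae_eq_zero_of_gap_nonpos` therefore splits t = f + g at a height δ. The part f ∈
[-1, δ] has entropy at least ‖f‖₂²/(2 + δ) and, apart from its zero mode, energy at least -λ‖f‖₂².
The tail g ≥ 0 has entropy at least a multiple of ∫ g, while the zero mode and every energy term
with g are bounded below by -o(1)·∫ g, because V is in L² and bounded below. Hence t = 0, a
contradiction.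

The second bound with λ = 0 reads 1 ≤ 0 and so produces a negative mode; decay of V̂ then makes the
minimum attained. -/

noncomputable section

namespace McKeanVlasov

open ComplexConjugate Submodule

/-! ### Fourier analysis on the torus: characters, Hilbert basis, Parseval. -/

section

variable {d : ℕ} {L : ℝ}

/-- The characters of the torus. -/
def torusChar (n : Fin d → ℤ) : C(Torus d L, ℂ) where
  toFun x := ∏ i, fourier (n i) (x i)
  continuous_toFun := by fun_prop

lemma torusChar_apply (n : Fin d → ℤ) (x : Torus d L) :
    torusChar n x = ∏ i, fourier (n i) (x i) := rfl

lemma torusChar_neg (n : Fin d → ℤ) (x : Torus d L) :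
    torusChar (-n) x = conj (torusChar n x) := by
  simp only [torusChar_apply, Pi.neg_apply, fourier_neg, map_prod]

lemma torusChar_add (m n : Fin d → ℤ) (x : Torus d L) :
    torusChar (m + n) x = torusChar m x * torusChar n x := by
  simp only [torusChar_apply, Pi.add_apply, fourier_add, ← Finset.prod_mul_distrib]

lemma torusChar_zero (x : Torus d L) : torusChar (0 : Fin d → ℤ) x = 1 := by
  simp [torusChar_apply]

lemma norm_torusChar (n : Fin d → ℤ) (x : Torus d L) : ‖torusChar n x‖ = 1 := by
  rw [torusChar_apply, norm_prod]
  exact Finset.prod_eq_one fun i _ => Circle.norm_coe _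

lemma torusChar_apply_add (n : Fin d → ℤ) (x y : Torus d L) :
    torusChar n (x + y) = torusChar n x * torusChar n y := by
  simp [torusChar_apply, fourier_apply, smul_add, AddCircle.toCircle_add, Finset.prod_mul_distrib]

lemma torusChar_apply_neg (n : Fin d → ℤ) (x : Torus d L) :
    torusChar n (-x) = conj (torusChar n x) := by
  rw [← torusChar_neg]
  simp [torusChar_apply, fourier_apply]

lemma torusChar_single (x : Torus d L) (i : Fin d) :
    torusChar (Pi.single i 1) x = fourier 1 (x i) := by
  rw [torusChar_apply, Finset.prod_eq_single i]
  · simp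
  · intro j _ hj
    simp [Pi.single_eq_of_ne hj]
  · simp

/-- The star subalgebra of continuous functions generated by the characters. -/
def torusCharSubalgebra (d : ℕ) (L : ℝ) : StarSubalgebra ℂ C(Torus d L, ℂ) where
  toSubalgebra := Algebra.adjoin ℂ (Set.range torusChar)
  star_mem' := by
    change Algebra.adjoin ℂ (Set.range torusChar) ≤ star (Algebra.adjoin ℂ (Set.range torusChar))
    refine Algebra.adjoin_le ?_
    rintro _ ⟨n, rfl⟩
    refine Algebra.subset_adjoin ⟨-n, ?_⟩
    ext1 x
    rw [torusChar_neg, starRingEnd_apply, ContinuousMap.star_apply]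

/-- The characters form a monoid under multiplication, so their linear span is already an algebra.
-/
lemma torusCharSubalgebra_coe :
    (torusCharSubalgebra d L).toSubalgebra.toSubmodule = span ℂ (Set.range torusChar) := by
  apply Algebra.adjoin_eq_span_of_subset
  refine .trans (fun x ↦ Submonoid.closure_induction (fun _ ↦ id) ⟨0, ?_⟩ ?_) subset_span
  · ext z
    simp [torusChar_zero]
  · rintro _ _ _ _ ⟨m, rfl⟩ ⟨n, rfl⟩
    exact ⟨m + n, ContinuousMap.ext fun x => torusChar_add m n x⟩

variable [Fact (0 < L)]

lemma volume_univ_torus : (volume : Measure (Torus d L)).real Set.univ = L ^ d := by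
  have hL : 0 < L := Fact.out
  rw [Measure.real, volume_pi, Measure.pi_univ]
  simp [hL.le]

lemma torusCharSubalgebra_separatesPoints : (torusCharSubalgebra d L).SeparatesPoints := by
  intro x y hxy
  obtain ⟨i, hi⟩ := Function.ne_iff.mp hxy
  refine ⟨torusChar (Pi.single i 1),
    ⟨torusChar (Pi.single i 1), Algebra.subset_adjoin ⟨Pi.single i 1, rfl⟩, rfl⟩, ?_⟩
  rw [torusChar_single, torusChar_single, fourier_one, fourier_one]
  contrapose hi
  exact AddCircle.injective_toCircle (Fact.out : 0 < L).ne' (Subtype.ext hi)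

/-- Stone–Weierstrass. -/
lemma span_torusChar_closure_eq_top :
    (span ℂ (Set.range (torusChar (d := d) (L := L)))).topologicalClosure = ⊤ := by
  rw [← torusCharSubalgebra_coe]
  exact congr_arg (Subalgebra.toSubmodule <| StarSubalgebra.toSubalgebra ·)
    (ContinuousMap.starSubalgebra_topologicalClosure_eq_top_of_separatesPoints _
      torusCharSubalgebra_separatesPoints)

lemma integral_torusChar (n : Fin d → ℤ) (hn : n ≠ 0) :
    ∫ x : Torus d L, torusChar n x = 0 := by
  obtain ⟨i, hi⟩ := Function.ne_iff.mp hn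
  have hi : n i ≠ 0 := hi
  have hL : 0 < L := Fact.out
  -- Translation by half a period in a coordinate with nonzero frequency flips the sign of the
  -- character, so its integral equals its own negative.
  set a : Torus d L := Pi.single i ((L / 2 / n i : ℝ) : AddCircle L)
  have ha : torusChar n a = -1 := by
    rw [torusChar_apply, Finset.prod_eq_single i]
    · have := fourier_add_half_inv_index hi hL (0 : AddCircle L)
      simpa [a] using this
    · intro j _ hj
      simp [a, Pi.single_eq_of_ne hj]
    · simp
  have h := integral_add_right_eq_self (μ := (volume : Measure (Torus d L)))
    (fun x => torusChar n x) a
  simp only [torusChar_apply_add, ha, mul_neg, mul_one, integral_neg] at h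
  exact self_eq_neg.mp h.symm

lemma memLp_torusChar (p : ENNReal) (n : Fin d → ℤ) :
    MemLp (torusChar (L := L) n) p volume :=
  MemLp.of_bound (torusChar n).continuous.aestronglyMeasurable 1
    (Eventually.of_forall fun x => (norm_torusChar n x).le)

/-- The normalized characters in `L²`. -/
def torusCharLp (n : Fin d → ℤ) : Lp ℂ 2 (volume : Measure (Torus d L)) :=
  ((√(L ^ d))⁻¹ : ℂ) • ContinuousMap.toLp (E := ℂ) 2 volume ℂ (torusChar n)

lemma coeFn_torusCharLp (n : Fin d → ℤ) :
    torusCharLp (L := L) n =ᵐ[volume] fun x => ((√(L ^ d))⁻¹ : ℂ) * torusChar n x := by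
  filter_upwards [Lp.coeFn_smul ((√(L ^ d))⁻¹ : ℂ)
    (ContinuousMap.toLp (E := ℂ) 2 volume ℂ (torusChar (L := L) n)),
    ContinuousMap.coeFn_toLp (p := 2) (𝕜 := ℂ) volume (torusChar (L := L) n)] with x h1 h2
  rw [torusCharLp, h1, Pi.smul_apply, h2, smul_eq_mul]

lemma orthonormal_torusCharLp : Orthonormal ℂ (torusCharLp (d := d) (L := L)) := by
  have hL : 0 < L := Fact.out
  rw [orthonormal_iff_ite]
  intro m n
  simp only [torusCharLp, inner_smul_left, inner_smul_right, ContinuousMap.inner_toLp]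
  have h : (fun x : Torus d L => torusChar n x * conj (torusChar m x)) =
      fun x => torusChar (n - m) x := by
    ext x
    rw [sub_eq_add_neg, torusChar_add, torusChar_neg]
  rw [h]
  split_ifs with hmn
  · subst hmn
    simp only [sub_self, torusChar_zero, integral_const, volume_univ_torus]
    have : ((√(L ^ d) : ℝ) : ℂ) * (√(L ^ d) : ℝ) = (L ^ d : ℝ) := by
      rw [← Complex.ofReal_mul, Real.mul_self_sqrt (by positivity)]
    have h0 : ((√(L ^ d) : ℝ) : ℂ) ≠ 0 := by
      rw [Complex.ofReal_ne_zero]; positivity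
    simp only [map_inv₀, Complex.conj_ofReal, Complex.real_smul, mul_one]
    rw [← this]
    field_simp
  · rw [integral_torusChar _ (sub_ne_zero.mpr (Ne.symm hmn))]
    simp

/-- The Hilbert basis of `L²` of the torus given by the normalized characters. -/
def torusBasis : HilbertBasis (Fin d → ℤ) ℂ (Lp ℂ 2 (volume : Measure (Torus d L))) :=
  HilbertBasis.mk orthonormal_torusCharLp <| by
    have hL : 0 < L := Fact.out
    have h : (span ℂ (Set.range fun n : Fin d → ℤ =>
        ContinuousMap.toLp (E := ℂ) 2 (volume : Measure (Torus d L)) ℂ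
          (torusChar n))).topologicalClosure = ⊤ := by
      simpa only [map_span, ContinuousLinearMap.coe_coe, ← Set.range_comp, Function.comp_def] using
        (ContinuousMap.toLp_denseRange ℂ (volume : Measure (Torus d L)) ℂ
          (p := 2) (by simp)).topologicalClosure_map_submodule span_torusChar_closure_eq_top
    rw [← h]
    refine Submodule.topologicalClosure_mono (span_le.mpr ?_)
    rintro _ ⟨n, rfl⟩
    have h0 : ((√(L ^ d) : ℝ) : ℂ) ≠ 0 := by
      rw [Complex.ofReal_ne_zero]; positivity
    have := Submodule.smul_mem (span ℂ (Set.range (torusCharLp (d := d) (L := L))))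
      ((√(L ^ d) : ℝ) : ℂ) (subset_span ⟨n, rfl⟩)
    rwa [torusCharLp, smul_smul, mul_inv_cancel₀ h0, one_smul] at this

lemma coe_torusBasis : ⇑(torusBasis (d := d) (L := L)) = torusCharLp := HilbertBasis.coe_mk _ _

/-- Fourier coefficients of a function on the torus. -/
def torusCoeff (f : Torus d L → ℂ) (n : Fin d → ℤ) : ℂ := ∫ x, f x * torusChar (-n) x

lemma inner_torusBasis {f : Torus d L → ℂ} (hf : MemLp f 2 volume) (n : Fin d → ℤ) :
    inner ℂ (torusBasis n) (hf.toLp f) = ((√(L ^ d))⁻¹ : ℂ) * torusCoeff f n := by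
  rw [coe_torusBasis, L2.inner_def, torusCoeff, ← integral_const_mul]
  apply integral_congr_ae
  filter_upwards [coeFn_torusCharLp (L := L) n, hf.coeFn_toLp] with x h1 h2
  rw [h1, h2, RCLike.inner_apply, map_mul, torusChar_neg, map_inv₀, Complex.conj_ofReal]
  ring

/-- **Parseval's identity** on the torus. -/
lemma hasSum_conj_torusCoeff_mul {f g : Torus d L → ℂ} (hf : MemLp f 2 volume)
    (hg : MemLp g 2 volume) :
    HasSum (fun n => conj (torusCoeff f n) * torusCoeff g n)
      ((L ^ d : ℝ) * ∫ x, conj (f x) * g x) := by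
  have hL : 0 < L := Fact.out
  have h := (torusBasis.hasSum_inner_mul_inner (hf.toLp f) (hg.toLp g)).mul_left ((L ^ d : ℝ) : ℂ)
  have h0 : ((√(L ^ d) : ℝ) : ℂ) ≠ 0 := by
    rw [Complex.ofReal_ne_zero]; positivity
  have hsq : ((L ^ d : ℝ) : ℂ) = ((√(L ^ d) : ℝ) : ℂ) * (√(L ^ d) : ℝ) := by
    rw [← Complex.ofReal_mul, Real.mul_self_sqrt (by positivity)]
  have e1 : (fun n => conj (torusCoeff f n) * torusCoeff g n) = fun n => ((L ^ d : ℝ) : ℂ) *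
      (inner ℂ (hf.toLp f) (torusBasis n) * inner ℂ (torusBasis n) (hg.toLp g)) := by
    ext n
    rw [← inner_conj_symm, inner_torusBasis, inner_torusBasis, hsq, map_mul, map_inv₀,
      Complex.conj_ofReal]
    field_simp
  have e2 : ∫ x, conj (f x) * g x = inner ℂ (hf.toLp f) (hg.toLp g) := by
    rw [L2.inner_def]
    apply integral_congr_ae
    filter_upwards [hf.coeFn_toLp, hg.coeFn_toLp] with x h1 h2
    rw [h1, h2, RCLike.inner_apply, mul_comm]
  rw [e1, e2]
  exact h

lemma hasSum_norm_sq_torusCoeff {f : Torus d L → ℂ} (hf : MemLp f 2 volume) :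
    HasSum (fun n => ‖torusCoeff f n‖ ^ 2) (L ^ d * ∫ x, ‖f x‖ ^ 2) := by
  have h := hasSum_conj_torusCoeff_mul hf hf
  simp only [Complex.conj_mul'] at h
  rw [show (∫ x, ((‖f x‖ : ℂ)) ^ 2) = ((∫ x, ‖f x‖ ^ 2 : ℝ) : ℂ) by
    rw [← integral_complex_ofReal]; simp] at h
  exact_mod_cast h

end

section

variable {d : ℕ} {L : ℝ} [Fact (0 < L)]

instance : (volume : Measure (Torus d L)).IsNegInvariant :=
  haveI : (volume : Measure (Torus d L)).Regular := inferInstance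
  inferInstance

/-! ### Pointwise bounds on the relative entropy. -/

/-- The density of relative entropy with respect to the uniform density, as a function of the
relative deviation `t` from the uniform density. -/
def entropyGap (t : ℝ) : ℝ := (1 + t) * Real.log (1 + t) - t

/-- Apply s ≤ sinh s to s = -log(1 + t) ≥ 0 and multiply by 1 + t; the endpoint t = -1, where the
gap is 1, is separate. -/
lemma sq_half_le_entropyGap_of_nonpos {t : ℝ} (h1 : -1 ≤ t) (h0 : t ≤ 0) :
    t ^ 2 / 2 ≤ entropyGap t := by
  unfold entropyGap
  rcases h1.eq_or_lt with rfl | h1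
  · norm_num
  have hp : 0 < 1 + t := by linarith
  have h := Real.self_le_sinh_iff.mpr (neg_nonneg.mpr (Real.log_nonpos hp.le (by linarith)))
  rw [Real.sinh_neg, Real.sinh_eq, Real.exp_neg, Real.exp_log hp] at h
  have h2 : (1 + t) * (-Real.log (1 + t)) ≤ (1 + t) * -((1 + t - (1 + t)⁻¹) / 2) :=
    mul_le_mul_of_nonneg_left h hp.le
  have h3 : (1 + t) * (1 + t)⁻¹ = 1 := mul_inv_cancel₀ hp.ne'
  nlinarith

lemma sq_div_le_entropyGap_of_nonneg {t : ℝ} (h0 : 0 ≤ t) :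
    t ^ 2 / (t + 2) ≤ entropyGap t := by
  unfold entropyGap
  have h := mul_le_mul_of_nonneg_left (Real.le_log_one_add_of_nonneg h0)
    (by linarith : 0 ≤ 1 + t)
  have h2 : t ^ 2 / (t + 2) = (1 + t) * (2 * t / (t + 2)) - t := by
    field_simp
    ring
  linarith

/-- The constant tends to the Taylor value 1/2 as δ → 0, which is what makes the threshold sharp. -/
lemma sq_div_le_entropyGap {δ t : ℝ} (hδ : 0 ≤ δ) (h1 : -1 ≤ t) (ht : t ≤ δ) :
    (2 + δ)⁻¹ * t ^ 2 ≤ entropyGap t := by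
  rcases le_total t 0 with h0 | h0
  · refine le_trans ?_ (sq_half_le_entropyGap_of_nonpos h1 h0)
    rw [div_eq_inv_mul]
    gcongr
    linarith
  · refine le_trans ?_ (sq_div_le_entropyGap_of_nonneg h0)
    rw [div_eq_inv_mul]
    gcongr 2
    linarith

/-- Monotonicity of t/(t + 2). Above height δ only linear growth is kept, since the tail is
controlled only in L¹. -/
lemma mul_le_entropyGap {δ t : ℝ} (hδ : 0 ≤ δ) (ht : δ ≤ t) :
    δ / (2 + δ) * t ≤ entropyGap t := by
  refine le_trans ?_ (sq_div_le_entropyGap_of_nonneg (hδ.trans ht))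
  have h0 : 0 ≤ t := hδ.trans ht
  rw [div_mul_eq_mul_div, div_le_div_iff₀ (by linarith) (by linarith)]
  nlinarith [mul_nonneg h0 (sub_nonneg.mpr ht)]

lemma entropyGap_nonneg {t : ℝ} (h1 : -1 ≤ t) : 0 ≤ entropyGap t :=
  le_trans (by positivity) (sq_div_le_entropyGap (abs_nonneg t) h1 (le_abs_self t))

lemma entropyGap_le {t : ℝ} (ht : |t| ≤ 1 / 2) : entropyGap t ≤ t ^ 2 / 2 + 4 * |t| ^ 3 := by
  unfold entropyGap
  have h := Real.abs_log_sub_add_sum_range_le (x := -t) (by rw [abs_neg]; linarith) 2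
  rw [Finset.sum_range_succ, Finset.sum_range_one, abs_neg, sub_neg_eq_add] at h
  norm_num at h
  have h2 : |t| ^ 3 / (1 - |t|) ≤ 2 * |t| ^ 3 := by
    rw [div_le_iff₀ (by linarith)]
    nlinarith [pow_nonneg (abs_nonneg t) 3]
  have h3 := (le_abs_self _).trans (h.trans h2)
  have hb := abs_le.mp ht
  have h4 : Real.log (1 + t) ≤ t - t ^ 2 / 2 + 2 * |t| ^ 3 := by linarith
  have h5 := mul_le_mul_of_nonneg_left h4 (by linarith : 0 ≤ 1 + t)
  have h6 : -t ^ 3 ≤ |t| ^ 3 := by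
    rw [← abs_pow]; exact neg_le_abs _
  nlinarith [pow_nonneg (abs_nonneg t) 3]

@[fun_prop]
lemma measurable_entropyGap : Measurable entropyGap := by
  unfold entropyGap
  fun_prop

/-! ### The energy as a bilinear form. -/

/-- The integrand of the energy. -/
def kernel (V u v : Torus d L → ℝ) (p : Torus d L × Torus d L) : ℝ := V (p.1 - p.2) * u p.1 * v p.2

lemma energy_eq (V u v : Torus d L → ℝ) : energy V u v = ∫ p, kernel V u v p := rfl

/-- The convolution integrand of two L¹ functions is integrable on the product; the bounded factor
does no harm. -/
lemma integrable_kernel_of_bounded_left {V u v : Torus d L → ℝ} (hV : Integrable V volume)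
    (hv : Integrable v volume) (hu : AEStronglyMeasurable u volume) {C : ℝ} (hC : ∀ x, |u x| ≤ C) :
    Integrable (kernel V u v) volume := by
  have h := hv.convolution_integrand (ContinuousLinearMap.mul ℝ ℝ) hV
  have h2 := h.bdd_mul (f := fun p : Torus d L × Torus d L => u p.1) (c := C) hu.comp_fst
    (Eventually.of_forall fun p => hC p.1)
  refine h2.congr (Eventually.of_forall fun p => ?_)
  simp only [kernel, ContinuousLinearMap.mul_apply']
  ring

lemma integrable_kernel_of_bounded_right {V u v : Torus d L → ℝ} (hV : Integrable V volume)
    (hu : Integrable u volume) (hv : AEStronglyMeasurable v volume) {C : ℝ} (hC : ∀ x, |v x| ≤ C) :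
    Integrable (kernel V u v) volume := by
  refine (integrable_kernel_of_bounded_left hV.comp_neg hu hv hC).swap.congr
    (Eventually.of_forall fun p => ?_)
  simp only [kernel, Function.comp_apply, Prod.fst_swap, Prod.snd_swap, neg_sub]
  ring

lemma energy_const_left {V v : Torus d L → ℝ} (hV : Integrable V volume)
    (hv : Integrable v volume) (c : ℝ) :
    energy V (fun _ => c) v = c * (∫ x, V x) * ∫ x, v x := by
  have h := integrable_kernel_of_bounded_left hV hv (u := fun _ => c) (by fun_prop)
    (fun _ => le_rfl)
  rw [energy_eq, Measure.volume_eq_prod, integral_prod_symm _ h]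
  simp only [kernel, integral_mul_const, integral_sub_right_eq_self (fun x => V x)]
  rw [integral_const_mul]
  ring

lemma energy_const_right {V u : Torus d L → ℝ} (hV : Integrable V volume)
    (hu : Integrable u volume) (c : ℝ) :
    energy V u (fun _ => c) = c * (∫ x, V x) * ∫ x, u x := by
  have h := integrable_kernel_of_bounded_right hV hu (v := fun _ => c) (by fun_prop)
    (fun _ => le_rfl)
  rw [energy_eq, Measure.volume_eq_prod, integral_prod _ h]
  have e (x : Torus d L) : ∫ y, kernel V u (fun _ => c) (x, y) = c * (∫ y, V y) * u x := by
    simp only [kernel, integral_mul_const, integral_sub_left_eq_self (fun x => V x)]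
    ring
  simp only [e, integral_const_mul]

lemma abs_integral_mul_le {X : Type*} [MeasurableSpace X] {μ : Measure X} {f g : X → ℝ}
    (hf : MemLp f 2 μ) (hg : MemLp g 2 μ) :
    |∫ x, f x * g x ∂μ| ≤ √(∫ x, f x ^ 2 ∂μ) * √(∫ x, g x ^ 2 ∂μ) := by
  have h := integral_mul_norm_le_Lp_mul_Lq (μ := μ) (f := f) (g := g) Real.HolderConjugate.two_two
    (by simpa using hf) (by simpa using hg)
  simp only [Real.norm_eq_abs, Real.rpow_two, sq_abs, ← Real.sqrt_eq_rpow] at h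
  refine (abs_integral_le_integral_abs).trans ?_
  simpa only [abs_mul] using h

/-- Cauchy–Schwarz in x for each fixed y, with translation invariance. The L² norm of f is what
later makes the cross terms o(1) times the mass of the tail. -/
lemma abs_energy_le_of_bounded_left {V f g : Torus d L → ℝ} (hV : Integrable V volume)
    (hV2 : MemLp V 2 volume) (hf : AEStronglyMeasurable f volume) {C : ℝ} (hC : ∀ x, |f x| ≤ C)
    (hg : Integrable g volume) :
    |energy V f g| ≤ √(∫ x, V x ^ 2) * √(∫ x, f x ^ 2) * ∫ x, |g x| := by
  have hf2 : MemLp f 2 volume := MemLp.of_bound hf C (Eventually.of_forall hC)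
  rw [energy_eq, Measure.volume_eq_prod,
    integral_prod_symm _ (integrable_kernel_of_bounded_left hV hg hf hC)]
  simp only [kernel, integral_mul_const]
  rw [← integral_const_mul, ← Real.norm_eq_abs]
  refine norm_integral_le_of_norm_le (hg.abs.const_mul _) (Eventually.of_forall fun y => ?_)
  rw [norm_mul, Real.norm_eq_abs, Real.norm_eq_abs]
  gcongr
  have := abs_integral_mul_le
    (hV2.comp_measurePreserving (measurePreserving_sub_right volume y)) hf2
  simpa only [Function.comp_apply, integral_sub_right_eq_self (fun x => V x ^ 2)] using this

lemma abs_energy_le_of_bounded_right {V f g : Torus d L → ℝ} (hV : Integrable V volume)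
    (hV2 : MemLp V 2 volume) (hf : AEStronglyMeasurable f volume) {C : ℝ} (hC : ∀ x, |f x| ≤ C)
    (hg : Integrable g volume) :
    |energy V g f| ≤ √(∫ x, V x ^ 2) * √(∫ x, f x ^ 2) * ∫ x, |g x| := by
  have hf2 : MemLp f 2 volume := MemLp.of_bound hf C (Eventually.of_forall hC)
  rw [energy_eq, Measure.volume_eq_prod,
    integral_prod _ (integrable_kernel_of_bounded_right hV hg hf hC)]
  have e (x : Torus d L) : ∫ y, kernel V g f (x, y) = (∫ y, V (x - y) * f y) * g x := by
    rw [← integral_mul_const]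
    congr 1 with y
    simp only [kernel]
    ring
  simp only [e]
  rw [← integral_const_mul, ← Real.norm_eq_abs]
  refine norm_integral_le_of_norm_le (hg.abs.const_mul _) (Eventually.of_forall fun x => ?_)
  rw [norm_mul, Real.norm_eq_abs, Real.norm_eq_abs]
  gcongr
  have := abs_integral_mul_le
    (hV2.comp_measurePreserving (Measure.measurePreserving_sub_left volume x)) hf2
  simpa only [Function.comp_apply, integral_sub_left_eq_self (fun x => V x ^ 2)] using this

lemma neg_mul_sq_le_energy {V g : Torus d L → ℝ} {B : ℝ} (hB : ∀ᵐ x, -B ≤ V x)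
    (hg0 : ∀ x, 0 ≤ g x) (hg : Integrable g volume) (hk : Integrable (kernel V g g) volume) :
    -B * (∫ x, g x) ^ 2 ≤ energy V g g := by
  have hq : ∀ᵐ p : Torus d L × Torus d L, -B ≤ V (p.1 - p.2) :=
    (quasiMeasurePreserving_sub volume volume).ae hB
  rw [energy_eq, sq, ← integral_prod_mul, ← integral_const_mul]
  refine integral_mono_ae ((hg.mul_prod hg).const_mul _) hk ?_
  filter_upwards [hq] with p hp
  simp only [kernel, mul_assoc]
  exact mul_le_mul_of_nonneg_right hp (mul_nonneg (hg0 _) (hg0 _))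

end

/-! ### Fourier form of the energy, and the free energy in terms of the deviation. -/

section

variable {d : ℕ} {L : ℝ}

lemma mul_log_eq {N t : ℝ} (hN : 0 < N) :
    N⁻¹ * (1 + t) * Real.log (N⁻¹ * (1 + t)) =
      N⁻¹ * (entropyGap t + t - Real.log N * (1 + t)) := by
  rcases eq_or_ne (1 + t) 0 with h | h
  · have : t = -1 := by linarith
    subst this
    simp [entropyGap]
  · rw [Real.log_mul (inv_ne_zero hN.ne') h, Real.log_inv, entropyGap]
    ring

/-- The probability density with relative deviation `t` from the uniform density. -/
def perturbed (t : Torus d L → ℝ) (x : Torus d L) : ℝ := (L ^ d)⁻¹ * (1 + t x)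

lemma kernel_perturbed (V t : Torus d L → ℝ) (p : Torus d L × Torus d L) :
    kernel V (perturbed t) (perturbed t) p = ((L ^ d)⁻¹) ^ 2 *
      (kernel V (fun _ => 1) (fun _ => 1) p + kernel V (fun _ => 1) t p
        + kernel V t (fun _ => 1) p + kernel V t t p) := by
  simp only [kernel, perturbed]
  ring

lemma perturbed_zero : perturbed (fun _ : Torus d L => 0) = uniformDensity d L := by
  ext x
  simp [perturbed, uniformDensity]

variable [Fact (0 < L)]

lemma fourierTransform_eq (V : Torus d L → ℝ) (n : Fin d → ℤ) :
    fourierTransform V n = torusCoeff (fun x => (V x : ℂ)) n := rfl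

lemma im_fourierTransform {V : Torus d L → ℝ} (hs : ∀ᵐ x, V (-x) = V x) (n : Fin d → ℤ) :
    (fourierTransform V n).im = 0 := by
  rw [← Complex.conj_eq_iff_im, fourierTransform_eq, torusCoeff, ← integral_conj,
    ← integral_neg_eq_self (fun x => (V x : ℂ) * torusChar (-n) x)]
  apply integral_congr_ae
  filter_upwards [hs] with x hx
  rw [hx, torusChar_apply_neg, map_mul, Complex.conj_ofReal]

lemma integrable_mul_torusChar {f : Torus d L → ℂ} (hf : Integrable f volume) (n : Fin d → ℤ) :
    Integrable (fun x => f x * torusChar n x) volume :=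
  hf.mul_bdd (c := 1) (torusChar n).continuous.aestronglyMeasurable
    (Eventually.of_forall fun x => (norm_torusChar n x).le)

/-- The convolution of `V` with `f`. -/
def potential (V f : Torus d L → ℝ) (x : Torus d L) : ℝ := ∫ y, V (x - y) * f y

/-- The convolution theorem: as characters are multiplicative, it is the formula for the integral of
a convolution, applied to both functions multiplied by the character. -/
lemma torusCoeff_potential {V f : Torus d L → ℝ} (hV : Integrable V volume)
    (hf : Integrable f volume) (n : Fin d → ℤ) :
    torusCoeff (fun x => (potential V f x : ℂ)) n =
      fourierTransform V n * torusCoeff (fun x => (f x : ℂ)) n := by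
  have h := integral_convolution (μ := (volume : Measure (Torus d L)))
    (ν := (volume : Measure (Torus d L))) (ContinuousLinearMap.mul ℂ ℂ)
    (integrable_mul_torusChar hf.ofReal (-n)) (integrable_mul_torusChar hV.ofReal (-n))
  rw [ContinuousLinearMap.mul_apply'] at h
  rw [fourierTransform_eq, mul_comm]
  refine Eq.trans ?_ h
  refine integral_congr_ae (Eventually.of_forall fun x => ?_)
  simp only [convolution_def, ContinuousLinearMap.mul_apply', potential]
  rw [← integral_complex_ofReal, ← integral_mul_const]
  refine integral_congr_ae (Eventually.of_forall fun y => ?_)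
  have : torusChar (-n) x = torusChar (-n) (x - y) * torusChar (-n) y := by
    rw [← torusChar_apply_add, sub_add_cancel]
  simp only [this, Complex.ofReal_mul]
  simp only [RCLike.ofReal_eq_complex_ofReal]
  ring

lemma memLp_potential {V f : Torus d L → ℝ} (hV : Integrable V volume)
    (hf : AEStronglyMeasurable f volume) {C : ℝ} (hC : ∀ x, |f x| ≤ C) (p : ENNReal) :
    MemLp (potential V f) p volume := by
  have hk := integrable_kernel_of_bounded_right hV (integrable_const (1 : ℝ)) hf hC
  rw [Measure.volume_eq_prod] at hk
  have hm := hk.integral_prod_left.aestronglyMeasurable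
  simp only [kernel, mul_one] at hm
  refine MemLp.of_bound hm (∫ x, |V x| * C) (Eventually.of_forall fun x => ?_)
  rw [← integral_sub_left_eq_self (fun y => |V y| * C) volume x]
  refine norm_integral_le_of_norm_le ((hV.abs.mul_const C).comp_sub_left x)
    (Eventually.of_forall fun y => ?_)
  rw [norm_mul]
  exact mul_le_mul_of_nonneg_left (hC y) (norm_nonneg _)

lemma integrable_of_bounded {f : Torus d L → ℝ}
    (hf : AEStronglyMeasurable f volume) {C : ℝ} (hC : ∀ x, |f x| ≤ C) : Integrable f volume :=
  Integrable.of_bound hf C (Eventually.of_forall hC)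

lemma energy_eq_integral_potential {V f : Torus d L → ℝ} (hV : Integrable V volume)
    (hf : AEStronglyMeasurable f volume) {C : ℝ} (hC : ∀ x, |f x| ≤ C) :
    energy V f f = ∫ x, f x * potential V f x := by
  rw [energy_eq, Measure.volume_eq_prod,
    integral_prod _ (integrable_kernel_of_bounded_right hV (integrable_of_bounded hf hC) hf hC)]
  congr 1 with x
  rw [potential, ← integral_const_mul]
  congr 1 with y
  simp only [kernel]
  ring

lemma hasSum_energy {V f : Torus d L → ℝ} (hV : Integrable V volume)
    (hf : AEStronglyMeasurable f volume) {C : ℝ} (hC : ∀ x, |f x| ≤ C) :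
    HasSum (fun n => (fourierTransform V n).re * ‖torusCoeff (fun x => (f x : ℂ)) n‖ ^ 2)
      (L ^ d * energy V f f) := by
  have hf1 := integrable_of_bounded hf hC
  have hf2 : MemLp f 2 volume := MemLp.of_bound hf C (Eventually.of_forall hC)
  have h := Complex.hasSum_re (hasSum_conj_torusCoeff_mul (hf2.ofReal (K := ℂ))
    ((memLp_potential hV hf hC 2).ofReal (K := ℂ)))
  have e1 := energy_eq_integral_potential hV hf hC
  have e2 : ∫ x, conj ((f x : ℂ)) * (potential V f x : ℂ) =
      ((∫ x, f x * potential V f x : ℝ) : ℂ) := by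
    rw [← integral_complex_ofReal]
    simp
  simp only [RCLike.ofReal_eq_complex_ofReal] at h
  rw [e2, ← e1, ← Complex.ofReal_mul, Complex.ofReal_re] at h
  convert! h using 2 with n
  rw [torusCoeff_potential hV hf1, mul_left_comm, Complex.conj_mul', ← Complex.ofReal_pow,
    Complex.re_mul_ofReal]

/-- Add `lam` times Parseval to the Fourier series of the energy: all terms with n ≠ 0 become
nonnegative, so the n = 0 term bounds the sum below. The zero mode is kept because a truncated
deviation need not have mean zero. -/
lemma energy_ge {V f : Torus d L → ℝ} (hV : Integrable V volume)
    (hf : AEStronglyMeasurable f volume) {C : ℝ} (hC : ∀ x, |f x| ≤ C) {lam : ℝ}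
    (hlam0 : 0 ≤ lam) (hlam : ∀ n : Fin d → ℤ, n ≠ 0 → -lam ≤ (fourierTransform V n).re) :
    -lam * (∫ x, f x ^ 2) + (L ^ d)⁻¹ * (fourierTransform V 0).re * (∫ x, f x) ^ 2 ≤
      energy V f f := by
  have hL : 0 < L := Fact.out
  have hf2 : MemLp f 2 volume := MemLp.of_bound hf C (Eventually.of_forall hC)
  have h := (hasSum_energy hV hf hC).add
    ((hasSum_norm_sq_torusCoeff (hf2.ofReal (K := ℂ))).mul_left lam)
  simp only [RCLike.norm_ofReal, sq_abs] at h
  have h0 := le_hasSum h 0 (fun n hn => by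
    have := hlam n hn
    simp only [RCLike.ofReal_eq_complex_ofReal, ← add_mul]
    have h2 : 0 ≤ (fourierTransform V n).re + lam := by linarith
    positivity)
  have e : torusCoeff (fun x => (f x : ℂ)) 0 = ((∫ x, f x : ℝ) : ℂ) := by
    rw [torusCoeff, ← integral_complex_ofReal]
    simp [torusChar_zero]
  simp only [RCLike.ofReal_eq_complex_ofReal, e, Complex.norm_real, Real.norm_eq_abs, sq_abs] at h0
  have hN : 0 < L ^ d := by positivity
  have h1 := mul_le_mul_of_nonneg_left h0 (inv_nonneg.mpr hN.le)
  have h2 : (L ^ d)⁻¹ * (L ^ d * energy V f f + lam * (L ^ d * ∫ x, f x ^ 2)) =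
    energy V f f + lam * ∫ x, f x ^ 2 := by field_simp
  rw [h2] at h1
  have h3 : 0 ≤ (L ^ d)⁻¹ * (lam * (∫ x, f x) ^ 2) := by positivity
  linarith

/-- By Parseval the coefficients of V tend to zero, so only finitely many lie at or below a given
negative value. -/
lemma exists_isMinimizingWaveVector {V : Torus d L → ℝ} (hV2 : MemLp V 2 volume)
    (h : ∃ n : Fin d → ℤ, n ≠ 0 ∧ (fourierTransform V n).re < 0) :
    ∃ n : Fin d → ℤ, IsMinimizingWaveVector V n ∧ (fourierTransform V n).re < 0 := by
  obtain ⟨n, hn, hneg⟩ := h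
  have hs := (hasSum_norm_sq_torusCoeff (hV2.ofReal (K := ℂ))).summable.tendsto_cofinite_zero
  have hfin : {m : Fin d → ℤ | m ≠ 0 ∧
      (fourierTransform V m).re ≤ (fourierTransform V n).re}.Finite := by
    have := hs.eventually (gt_mem_nhds (show 0 < (fourierTransform V n).re ^ 2 by nlinarith))
    refine Set.Finite.subset this fun m hm => ?_
    simp only [Set.mem_compl_iff, Set.mem_ofPred_eq, not_lt]
    change _ ≤ ‖fourierTransform V m‖ ^ 2
    rw [sq_le_sq, abs_norm]
    refine le_trans ?_ (Complex.abs_re_le_norm _)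
    rw [abs_of_neg hneg, abs_of_neg (hm.2.trans_lt hneg)]
    linarith [hm.2]
  obtain ⟨k, ⟨hk0, hk1⟩, hk⟩ := Set.exists_min_image _ (fun m => (fourierTransform V m).re) hfin
    ⟨n, hn, le_rfl⟩
  refine ⟨k, ⟨hk0, fun m hm => ?_⟩, hk1.trans_lt hneg⟩
  rcases le_total (fourierTransform V m).re (fourierTransform V n).re with hmn | hmn
  · exact hk m ⟨hm, hmn⟩
  · exact hk1.trans hmn

lemma freeEnergy_perturbed {V t : Torus d L → ℝ} (hV : Integrable V volume)
    (ht : Integrable t volume) (ht0 : ∫ x, t x = 0)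
    (hgap : Integrable (fun x => entropyGap (t x)) volume)
    (hk : Integrable (kernel V t t) volume) (θ : ℝ) :
    freeEnergy V θ (perturbed t) =
      ((-Real.log (L ^ d) + 1 / 2 * θ * (∫ x, V x) +
        (L ^ d)⁻¹ * ((∫ x, entropyGap (t x)) + 1 / 2 * θ * energy V t t) : ℝ) : EReal) := by
  have hL : 0 < L := Fact.out
  have hN : 0 < L ^ d := by positivity
  have i1 := integrable_const (μ := (volume : Measure (Torus d L))) (1 : ℝ)
  have k11 := integrable_kernel_of_bounded_left hV i1 (u := fun _ => 1) (by fun_prop)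
    (fun _ => le_rfl)
  have k1t := integrable_kernel_of_bounded_left hV ht (u := fun _ => 1) (by fun_prop)
    (fun _ => le_rfl)
  have kt1 := integrable_kernel_of_bounded_right hV ht (v := fun _ => 1) (by fun_prop)
    (fun _ => le_rfl)
  have ikk : Integrable (kernel V (perturbed t) (perturbed t)) volume := by
    rw [funext (kernel_perturbed V t)]
    exact (((k11.add k1t).add kt1).add hk).const_mul _
  have hlog (x) : perturbed t x * Real.log (perturbed t x) = (L ^ d)⁻¹ *
      (entropyGap (t x) + t x - Real.log (L ^ d) * (1 + t x)) := mul_log_eq hN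
  have ig := hgap.add ht
  have il := (i1.add ht).const_mul (Real.log (L ^ d))
  have ient : Integrable (fun x => perturbed t x * Real.log (perturbed t x)) volume := by
    rw [funext hlog]
    exact (ig.sub il).const_mul _
  have hS : entropy (perturbed t) = (L ^ d)⁻¹ * (∫ x, entropyGap (t x)) - Real.log (L ^ d) := by
    rw [entropy, funext hlog, integral_const_mul, integral_sub (by exact ig) (by exact il),
      integral_add hgap ht, integral_const_mul, integral_add i1 ht, ht0, integral_const,
      volume_univ_torus, smul_eq_mul]
    field_simp
    ring
  have hE : energy V (perturbed t) (perturbed t) =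
      ((L ^ d)⁻¹) ^ 2 * ((∫ x, V x) * L ^ d + energy V t t) := by
    rw [energy_eq, funext (kernel_perturbed V t), integral_const_mul,
      integral_add (by exact (k11.add k1t).add kt1) hk, integral_add (by exact k11.add k1t) kt1,
      integral_add k11 k1t, ← energy_eq, ← energy_eq, ← energy_eq, ← energy_eq,
      energy_const_left hV i1, energy_const_left hV ht, energy_const_right hV ht, ht0,
      integral_const, volume_univ_torus, smul_eq_mul]
    ring
  rw [freeEnergy, if_pos ⟨ient, ikk⟩, hS, hE]
  congr 1
  field_simp
  ring

lemma integrable_of_freeEnergy_ne_top {V t : Torus d L → ℝ} (hV : Integrable V volume)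
    (ht : Integrable t volume) {θ : ℝ} (h : freeEnergy V θ (perturbed t) ≠ ⊤) :
    Integrable (fun x => entropyGap (t x)) volume ∧ Integrable (kernel V t t) volume := by
  have hL : 0 < L := Fact.out
  have hN : 0 < L ^ d := by positivity
  have i1 := integrable_const (μ := (volume : Measure (Torus d L))) (1 : ℝ)
  have k11 := integrable_kernel_of_bounded_left hV i1 (u := fun _ => 1) (by fun_prop)
    (fun _ => le_rfl)
  have k1t := integrable_kernel_of_bounded_left hV ht (u := fun _ => 1) (by fun_prop)
    (fun _ => le_rfl)
  have kt1 := integrable_kernel_of_bounded_right hV ht (v := fun _ => 1) (by fun_prop)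
    (fun _ => le_rfl)
  rw [freeEnergy] at h
  split_ifs at h with hi
  · obtain ⟨hi1, hi2⟩ := hi
    constructor
    · refine (((hi1.const_mul (L ^ d)).sub ht).add
        ((i1.add ht).const_mul (Real.log (L ^ d)))).congr (Eventually.of_forall fun x => ?_)
      have := mul_log_eq hN (t := t x)
      simp only [Pi.add_apply, Pi.sub_apply, perturbed, this]
      field_simp
      ring
    · refine (((hi2.const_mul ((L ^ d) ^ 2)).sub ((k11.add k1t).add kt1))).congr
        (Eventually.of_forall fun p => ?_)
      have := kernel_perturbed V t p
      rw [kernel] at this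
      simp only [Pi.add_apply, Pi.sub_apply, this]
      field_simp
      ring
  · exact absurd rfl h

lemma isDensity_perturbed {t : Torus d L → ℝ} (ht : Integrable t volume) (ht0 : ∫ x, t x = 0)
    (h1 : ∀ x, -1 ≤ t x) : IsDensity (perturbed t) := by
  have hL : 0 < L := Fact.out
  have hN : 0 < L ^ d := by positivity
  have i1 := integrable_const (μ := (volume : Measure (Torus d L))) (1 : ℝ)
  refine ⟨(i1.add ht).const_mul _, Eventually.of_forall fun x => ?_, ?_⟩
  · exact mul_nonneg (by positivity) (by linarith [h1 x])
  · simp only [perturbed]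
    rw [integral_const_mul, integral_add i1 ht, ht0, integral_const, volume_univ_torus, smul_eq_mul]
    field_simp
    ring

lemma isDensity_uniformDensity : IsDensity (uniformDensity d L) := by
  rw [← perturbed_zero]
  exact isDensity_perturbed (integrable_zero _ _ _) (by simp) (by norm_num)

lemma freeEnergy_uniformDensity {V : Torus d L → ℝ} (hV : Integrable V volume) (θ : ℝ) :
    freeEnergy V θ (uniformDensity d L) =
      ((-Real.log (L ^ d) + 1 / 2 * θ * (∫ x, V x) : ℝ) : EReal) := by
  have hk : kernel V (fun _ => 0) (fun _ => 0) = fun _ => 0 := by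
    ext p
    simp [kernel]
  rw [← perturbed_zero, freeEnergy_perturbed hV (t := fun _ => 0) (integrable_zero _ _ _) (by simp)
    (by simp [entropyGap]) (by rw [hk]; exact integrable_zero _ _ _)]
  simp [entropyGap, energy]

end

/-! ### Rigidity near the uniform density, giving θc λ ≥ 1. -/

section

variable {d : ℕ} {L : ℝ} [Fact (0 < L)]

lemma kernel_ae_congr {V u u' v v' : Torus d L → ℝ} (hu : u =ᵐ[volume] u')
    (hv : v =ᵐ[volume] v') : kernel V u v =ᵐ[volume] kernel V u' v' := by
  have h1 : ∀ᵐ p : Torus d L × Torus d L, u p.1 = u' p.1 :=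
    Measure.quasiMeasurePreserving_fst.ae hu
  have h2 : ∀ᵐ p : Torus d L × Torus d L, v p.2 = v' p.2 :=
    Measure.quasiMeasurePreserving_snd.ae hv
  filter_upwards [h1, h2] with p h1 h2
  rw [kernel, kernel, h1, h2]

lemma freeEnergy_congr_ae {V ρ ρ' : Torus d L → ℝ} (h : ρ =ᵐ[volume] ρ') (θ : ℝ) :
    freeEnergy V θ ρ = freeEnergy V θ ρ' := by
  have h1 : (fun x => ρ x * Real.log (ρ x)) =ᵐ[volume] fun x => ρ' x * Real.log (ρ' x) := by
    filter_upwards [h] with x hx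
    rw [hx]
  have h2 := kernel_ae_congr (V := V) h h
  have e1 : entropy ρ = entropy ρ' := integral_congr_ae h1
  have e2 : energy V ρ ρ = energy V ρ' ρ' := integral_congr_ae h2
  unfold freeEnergy
  rw [e1, e2]
  congr 1
  exact propext (and_congr (integrable_congr h1) (integrable_congr h2))

lemma exists_deviation_of_isMinimizer {V ρ : Torus d L → ℝ} (hV : Integrable V volume) {θ : ℝ}
    (hρ : IsMinimizer V θ ρ) :
    ∃ t : Torus d L → ℝ, (∀ x, -1 ≤ t x) ∧ Integrable t volume ∧ ∫ x, t x = 0 ∧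
      ρ =ᵐ[volume] perturbed t ∧ Integrable (fun x => entropyGap (t x)) volume ∧
      Integrable (kernel V t t) volume ∧
      (∫ x, entropyGap (t x)) + 1 / 2 * θ * energy V t t ≤ 0 := by
  have hL : 0 < L := Fact.out
  have hN : 0 < L ^ d := by positivity
  obtain ⟨hd, hmin⟩ := hρ
  -- The positive part makes t ≥ -1 hold everywhere rather than almost everywhere.
  set t : Torus d L → ℝ := fun x => L ^ d * max (ρ x) 0 - 1 with ht
  have hmax : ρ =ᵐ[volume] fun x => max (ρ x) 0 := by
    filter_upwards [hd.nonneg] with x hx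
    rw [max_eq_left hx]
  have hp : perturbed t = fun x => max (ρ x) 0 := by
    ext x
    simp only [perturbed, ht]
    field_simp
    ring
  have hae : ρ =ᵐ[volume] perturbed t := hp ▸ hmax
  have himax : Integrable (fun x => max (ρ x) 0) volume := hd.integrable.congr hmax
  have hti : Integrable t volume := (himax.const_mul _).sub (integrable_const _)
  have ht0 : ∫ x, t x = 0 := by
    rw [ht, integral_sub (himax.const_mul _) (integrable_const _), integral_const_mul,
      ← integral_congr_ae hmax, hd.integral_eq_one, integral_const, volume_univ_torus]
    simp
  have hle := hmin _ isDensity_uniformDensity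
  rw [freeEnergy_uniformDensity hV, freeEnergy_congr_ae hae] at hle
  obtain ⟨hg, hk⟩ := integrable_of_freeEnergy_ne_top hV hti
    (ne_top_of_le_ne_top (EReal.coe_ne_top _) hle)
  refine ⟨t, fun x => ?_, hti, ht0, hae, hg, hk, ?_⟩
  · have := mul_nonneg hN.le (le_max_right (ρ x) 0)
    simp only [ht]
    linarith
  · rw [freeEnergy_perturbed hV hti ht0 hg hk, EReal.coe_le_coe_iff] at hle
    have h : (L ^ d)⁻¹ * ((∫ x, entropyGap (t x)) + 1 / 2 * θ * energy V t t) ≤ 0 := by linarith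
    exact nonpos_of_mul_nonpos_right h (inv_pos.mpr hN)

/-- A deviation from the uniform density that is small in `L¹` and does not raise the free energy
vanishes, below the threshold of linear instability. -/
lemma ae_eq_zero_of_gap_nonpos {V t : Torus d L → ℝ} (hV : Integrable V volume)
    (hV2 : MemLp V 2 volume) {B : ℝ} (hB0 : 0 ≤ B) (hB : ∀ᵐ x, -B ≤ V x) {lam : ℝ}
    (hlam0 : 0 ≤ lam) (hlam : ∀ n : Fin d → ℤ, n ≠ 0 → -lam ≤ (fourierTransform V n).re)
    {θ : ℝ} (hθ : 0 ≤ θ) (h1 : ∀ x, -1 ≤ t x) (ht : Integrable t volume) (ht0 : ∫ x, t x = 0)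
    (hgap : Integrable (fun x => entropyGap (t x)) volume)
    (hk : Integrable (kernel V t t) volume)
    (hle : (∫ x, entropyGap (t x)) + 1 / 2 * θ * energy V t t ≤ 0)
    {δ : ℝ} (hδ0 : 0 < δ) (hδ1 : δ ≤ 1) (hδ : 0 < (2 + δ)⁻¹ - θ * lam / 2)
    (hsmall : 0 < δ / (2 + δ) - θ / 2 * (((L ^ d)⁻¹ * |(fourierTransform V 0).re| + B) *
      (∫ x, |t x|) + 2 * √(∫ x, V x ^ 2) * √(∫ x, |t x|))) :
    t =ᵐ[volume] 0 := by
  set φ : ℝ → ℝ := fun s => if s ≤ δ then s else 0 with hφ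
  set ψ : ℝ → ℝ := fun s => if s ≤ δ then 0 else s with hψ
  have hφm : Measurable φ := Measurable.ite measurableSet_Iic measurable_id measurable_const
  have hψm : Measurable ψ := Measurable.ite measurableSet_Iic measurable_const measurable_id
  set f : Torus d L → ℝ := fun x => φ (t x) with hf
  set g : Torus d L → ℝ := fun x => ψ (t x) with hg
  have hfm : AEStronglyMeasurable f volume :=
    (hφm.comp_aemeasurable ht.aemeasurable).aestronglyMeasurable
  have hgm : AEStronglyMeasurable g volume :=
    (hψm.comp_aemeasurable ht.aemeasurable).aestronglyMeasurable
  have hfg (x) : t x = f x + g x := by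
    simp only [hf, hg, hφ, hψ]; split_ifs <;> simp
  have hfC (x) : |f x| ≤ 1 := by
    simp only [hf, hφ]
    split_ifs with h
    · exact abs_le.mpr ⟨h1 x, h.trans hδ1⟩
    · simp
  have hg0 (x) : 0 ≤ g x := by
    simp only [hg, hψ]
    split_ifs with h
    · exact le_rfl
    · exact hδ0.le.trans (not_le.mp h).le
  have hgt (x) : g x ≤ |t x| := by
    simp only [hg, hψ]
    split_ifs with h
    · exact abs_nonneg _
    · exact le_abs_self _
  have hft (x) : f x ^ 2 ≤ |t x| := by
    have : |f x| ≤ |t x| := by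
      simp only [hf, hφ]
      split_ifs
      · exact le_rfl
      · simp
    rw [← sq_abs]
    nlinarith [hfC x, abs_nonneg (f x)]
  have hfi := integrable_of_bounded hfm hfC
  have hf2i : Integrable (fun x => f x ^ 2) volume :=
    (MemLp.of_bound (p := 2) hfm 1 (Eventually.of_forall hfC)).integrable_sq
  have hgi : Integrable g volume := ht.mono hgm (Eventually.of_forall fun x => by
    rw [Real.norm_of_nonneg (hg0 x)]; exact hgt x)
  have kff := integrable_kernel_of_bounded_right hV hfi hfm hfC
  have kfg := integrable_kernel_of_bounded_left hV hgi hfm hfC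
  have kgf := integrable_kernel_of_bounded_right hV hgi hfm hfC
  have hsplit (p) : kernel V t t p =
      kernel V f f p + kernel V f g p + kernel V g f p + kernel V g g p := by
    simp only [kernel, hfg]
    ring
  have kgg : Integrable (kernel V g g) volume := by
    refine (hk.sub ((kff.add kfg).add kgf)).congr (Eventually.of_forall fun p => ?_)
    simp only [Pi.sub_apply, Pi.add_apply, hsplit]
    ring
  have hE : energy V t t = energy V f f + energy V f g + energy V g f + energy V g g := by
    rw [energy_eq, funext hsplit, integral_add (by exact (kff.add kfg).add kgf) kgg,
      integral_add (by exact kff.add kfg) kgf, integral_add kff kfg]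
    rfl
  set m := ∫ x, |t x| with hm
  set Φ := ∫ x, f x ^ 2 with hΦ
  set G := ∫ x, g x with hG
  set c := √(∫ x, V x ^ 2) with hc
  set C₀ := (L ^ d)⁻¹ * |(fourierTransform V 0).re| with hC₀
  have hΦ0 : 0 ≤ Φ := integral_nonneg fun x => sq_nonneg _
  have hG0 : 0 ≤ G := integral_nonneg hg0
  have hGm : G ≤ m := integral_mono hgi ht.abs hgt
  have hΦm : Φ ≤ m := integral_mono hf2i ht.abs hft
  have hC₀0 : 0 ≤ C₀ := by have : 0 < L := Fact.out; positivity
  -- Since t has mean zero, the zero mode of f is governed by the mass G of the tail.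
  have hfG : ∫ x, f x = -G := by
    have : ∫ x, t x = (∫ x, f x) + ∫ x, g x := by
      rw [funext hfg, integral_add hfi hgi]
    linarith
  have hgabs : ∫ x, |g x| = G := by
    simp only [abs_of_nonneg (hg0 _), hG]
  have e1 := energy_ge hV hfm hfC hlam0 hlam
  rw [hfG, neg_sq] at e1
  have e1' : -C₀ * G ^ 2 ≤ (L ^ d)⁻¹ * (fourierTransform V 0).re * G ^ 2 := by
    have hL : 0 < L := Fact.out
    rw [hC₀, ← mul_neg]
    gcongr
    exact neg_abs_le _
  have e2 := (abs_le.mp (abs_energy_le_of_bounded_left hV hV2 hfm hfC hgi)).1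
  have e3 := (abs_le.mp (abs_energy_le_of_bounded_right hV hV2 hfm hfC hgi)).1
  rw [hgabs] at e2 e3
  have e4 := neg_mul_sq_le_energy hB hg0 hgi kgg
  -- Apart from -`lam` Φ every loss carries a factor G; its other factors are bounded through G ≤ m
  -- and Φ ≤ m, hence small with m.
  have hEge : -lam * Φ - G * ((C₀ + B) * m + 2 * c * √m) ≤ energy V t t := by
    have h5 : G * ((C₀ + B) * G + 2 * c * √Φ) ≤ G * ((C₀ + B) * m + 2 * c * √m) := by
      gcongr
    rw [hE]
    linarith
  have hS : (2 + δ)⁻¹ * Φ + δ / (2 + δ) * G ≤ ∫ x, entropyGap (t x) := by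
    rw [hΦ, hG, ← integral_const_mul, ← integral_const_mul,
      ← integral_add (hf2i.const_mul _) (hgi.const_mul _)]
    refine integral_mono ((hf2i.const_mul _).add (hgi.const_mul _)) hgap fun x => ?_
    simp only [hf, hg, hφ, hψ]
    split_ifs with h
    · simpa using sq_div_le_entropyGap hδ0.le (h1 x) h
    · simpa using mul_le_entropyGap hδ0.le (not_le.mp h).le
  have hfin : ((2 + δ)⁻¹ - θ * lam / 2) * Φ +
      (δ / (2 + δ) - θ / 2 * ((C₀ + B) * m + 2 * c * √m)) * G ≤ 0 := by
    have := mul_le_mul_of_nonneg_left hEge (by positivity : 0 ≤ 1 / 2 * θ)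
    linarith
  have p1 := mul_nonneg hδ.le hΦ0
  have p2 := mul_nonneg hsmall.le hG0
  have hΦz : Φ = 0 := (mul_eq_zero.mp (by linarith : _ * Φ = 0)).resolve_left hδ.ne'
  have hGz : G = 0 := (mul_eq_zero.mp (by linarith : _ * G = 0)).resolve_left hsmall.ne'
  have z1 := (integral_eq_zero_iff_of_nonneg (fun x => sq_nonneg (f x)) hf2i).mp hΦz
  have z2 := (integral_eq_zero_iff_of_nonneg hg0 hgi).mp hGz
  filter_upwards [z1, z2] with x hx1 hx2
  have hx1 : f x = 0 := by simpa using hx1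
  have hx2 : g x = 0 := hx2
  rw [hfg, hx1, hx2]
  simp

lemma exists_lower_bound {V : Torus d L → ℝ} (hV : IsPotential V) :
    ∃ B : ℝ, 0 ≤ B ∧ ∀ᵐ x, -B ≤ V x := by
  have hfin := hV.bounded_negPart.eLpNorm_ne_top
  rw [eLpNorm_exponent_top] at hfin
  refine ⟨(eLpNormEssSup (fun x => max (-V x) 0) volume).toReal, ENNReal.toReal_nonneg, ?_⟩
  filter_upwards [ae_le_eLpNormEssSup (f := fun x => max (-V x) 0)
    (μ := (volume : Measure (Torus d L)))] with x hx
  have h := ENNReal.toReal_mono hfin hx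
  rw [toReal_enorm, Real.norm_eq_abs] at h
  linarith [(le_max_left (-V x) 0).trans ((le_abs_self _).trans h)]

lemma one_le_mul_of_isLowerCriticalPoint {V : Torus d L → ℝ} (hV : IsPotential V)
    (hV2 : MemLp V 2 volume) {θc : ℝ} (hc : IsLowerCriticalPoint V θc) {lam : ℝ}
    (hlam0 : 0 ≤ lam) (hlam : ∀ n : Fin d → ℤ, n ≠ 0 → -lam ≤ (fourierTransform V n).re) :
    1 ≤ θc * lam := by
  by_contra! hlt
  have hL : 0 < L := Fact.out
  have hN : 0 < L ^ d := by positivity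
  obtain ⟨B, hB0, hB⟩ := exists_lower_bound hV
  choose! ρ hρ using hc.exists_above
  have hlim := (hc.tendsto_uniform ρ hρ).const_mul (L ^ d)
  rw [mul_zero] at hlim
  have hnn := mul_nonneg hc.nonneg hlam0
  -- This height works because (1 - δ)(2 + δ) < 2, that is, θc `lam`/2 < 1/(2 + δ). Both strict
  -- inequalities needed hold in the limit θ ↓ θc, hence at some θ > θc.
  set δ := 1 - θc * lam with hδ
  have hδ0 : 0 < δ := by linarith
  have hid : Tendsto (fun θ : ℝ => θ) (𝓝[>] θc) (𝓝 θc) := nhdsWithin_le_nhds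
  set m : ℝ → ℝ := fun θ => L ^ d * ∫ x, |uniformDensity d L x - ρ θ x|
  have l1 : Tendsto (fun θ => (2 + δ)⁻¹ - θ * lam / 2) (𝓝[>] θc)
      (𝓝 ((2 + δ)⁻¹ - θc * lam / 2)) := ((hid.mul_const _).div_const _).const_sub _
  have l2 : Tendsto (fun θ => δ / (2 + δ) -
      θ / 2 * (((L ^ d)⁻¹ * |(fourierTransform V 0).re| + B) * m θ +
        2 * √(∫ x, V x ^ 2) * √(m θ))) (𝓝[>] θc) (𝓝 (δ / (2 + δ) -
      θc / 2 * (((L ^ d)⁻¹ * |(fourierTransform V 0).re| + B) * 0 +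
        2 * √(∫ x, V x ^ 2) * √0))) :=
    ((hid.div_const 2).mul ((hlim.const_mul _).add
      ((hlim.sqrt).const_mul _))).const_sub _
  have p1 : 0 < (2 + δ)⁻¹ - θc * lam / 2 := by
    rw [sub_pos, ← one_div, lt_div_iff₀ (by linarith)]
    nlinarith
  rw [Real.sqrt_zero, mul_zero, mul_zero, add_zero, mul_zero, sub_zero] at l2
  obtain ⟨θ, hθ1, hθ2, hθ⟩ := ((l1.eventually_const_lt p1).and
    ((l2.eventually_const_lt (by positivity : 0 < δ / (2 + δ))).and
      self_mem_nhdsWithin)).exists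
  have hθ : θc < θ := hθ
  obtain ⟨hmin, hne⟩ := hρ θ hθ
  obtain ⟨t, h1, ht, ht0, hae, hgap, hk, hle⟩ := exists_deviation_of_isMinimizer hV.integrable hmin
  have hmt : m θ = ∫ x, |t x| := by
    simp only [m]
    rw [← integral_const_mul]
    apply integral_congr_ae
    filter_upwards [hae] with x hx
    rw [hx, uniformDensity, perturbed, ← abs_of_pos hN, ← abs_mul, abs_of_pos hN, ← abs_neg]
    congr 1
    field_simp
    ring
  rw [hmt] at hθ2
  have hz := ae_eq_zero_of_gap_nonpos hV.integrable hV2 hB0 hB hlam0 hlam (hc.nonneg.trans hθ.le)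
    h1 ht ht0 hgap hk hle hδ0 (by linarith) hθ1 hθ2
  refine hne ?_
  filter_upwards [hae, hz] with x hx hzx
  rw [hx, perturbed, hzx, uniformDensity]
  simp

end

/-! ### Linear stability tested with plane waves, giving θc λ ≤ 1. -/

section

variable {d : ℕ} {L : ℝ}

/-- The plane wave `cos (k · x)`. -/
def planeWave (n : Fin d → ℤ) (x : Torus d L) : ℝ := (torusChar n x).re

lemma continuous_planeWave (n : Fin d → ℤ) : Continuous (planeWave (L := L) n) :=
  Complex.continuous_re.comp (torusChar n).continuous

lemma abs_planeWave_le (n : Fin d → ℤ) (x : Torus d L) : |planeWave n x| ≤ 1 :=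
  (Complex.abs_re_le_norm _).trans (norm_torusChar n x).le

variable [Fact (0 < L)]

lemma integral_planeWave {n : Fin d → ℤ} (hn : n ≠ 0) : ∫ x : Torus d L, planeWave n x = 0 := by
  have h := integral_re (μ := (volume : Measure (Torus d L))) (𝕜 := ℂ)
    ((memLp_torusChar 1 n).integrable le_rfl)
  rw [integral_torusChar n hn] at h
  simpa [planeWave] using h

lemma integral_planeWave_sq_pos (n : Fin d → ℤ) : 0 < ∫ x : Torus d L, planeWave n x ^ 2 := by
  refine (continuous_planeWave n).pow 2 |>.integral_pos_of_hasCompactSupport_nonneg_nonzero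
    (HasCompactSupport.of_compactSpace _) (fun x => sq_nonneg _) (x := 0) ?_
  simp [planeWave, torusChar_apply]

/-- Characters are eigenfunctions of convolution with V; the eigenvalue is real by symmetry, so real
parts can be taken. -/
lemma potential_planeWave {V : Torus d L → ℝ} (hV : Integrable V volume)
    (hs : ∀ᵐ x, V (-x) = V x) (n : Fin d → ℤ) (x : Torus d L) :
    potential V (planeWave n) x = (fourierTransform V n).re * planeWave n x := by
  have h : fourierTransform V n * torusChar n x = ((fourierTransform V n).re : ℂ) * torusChar n x := by
    congr 1
    exact Complex.ext rfl (im_fourierTransform hs n)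
  have h2 := congrArg Complex.re h
  rw [Complex.re_ofReal_mul] at h2
  rw [planeWave, ← h2, fourierTransform_eq, torusCoeff, ← integral_mul_const, potential,
    ← integral_sub_left_eq_self (fun y => (V y : ℂ) * torusChar (-n) y * torusChar n x) volume x]
  have hi : Integrable (fun y => (V (x - y) : ℂ) * torusChar (-n) (x - y) * torusChar n x)
      volume :=
    ((integrable_mul_torusChar hV.ofReal (-n)).mul_const (torusChar n x)).comp_sub_left x
  refine Eq.trans ?_ (integral_re hi)
  congr 1 with y
  have : torusChar (-n) (x - y) * torusChar n x = torusChar n y := by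
    rw [torusChar_neg, ← torusChar_apply_neg, ← torusChar_apply_add]
    congr 1
    abel
  rw [mul_assoc, this]
  simp [planeWave]

lemma energy_planeWave {V : Torus d L → ℝ} (hV : Integrable V volume)
    (hs : ∀ᵐ x, V (-x) = V x) (n : Fin d → ℤ) :
    energy V (planeWave n) (planeWave n) =
      (fourierTransform V n).re * ∫ x : Torus d L, planeWave n x ^ 2 := by
  rw [energy_eq_integral_potential hV (continuous_planeWave n).aestronglyMeasurable
    (abs_planeWave_le n), ← integral_const_mul]
  congr 1 with x
  rw [potential_planeWave hV hs]
  ring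

/-- Linear stability of the uniform density when it is a minimizer. -/
lemma stability_of_isMinimizer {V : Torus d L → ℝ} (hV : Integrable V volume)
    (hs : ∀ᵐ x, V (-x) = V x) {θ : ℝ} (hmin : IsMinimizer V θ (uniformDensity d L))
    {n : Fin d → ℤ} (hn : n ≠ 0) : 0 ≤ 1 + θ * (fourierTransform V n).re := by
  have hL : 0 < L := Fact.out
  have hN : 0 < L ^ d := by positivity
  set M := ∫ x : Torus d L, planeWave n x ^ 2 with hM
  have hMpos : 0 < M := integral_planeWave_sq_pos n
  have hcont := continuous_planeWave (L := L) n
  -- Twice the excess bound divided by ε²; the cubic Taylor error 4ε³L^d becomes 8εL^d and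
  -- disappears as ε ↓ 0.
  have key (ε : ℝ) (h0 : 0 < ε) (h1 : ε ≤ 1 / 2) :
      0 ≤ M * (1 + θ * (fourierTransform V n).re) + ε * (8 * L ^ d) := by
    set t : Torus d L → ℝ := fun x => ε * planeWave n x with ht
    have habs (x) : |t x| ≤ ε := by
      rw [ht, abs_mul, abs_of_pos h0]
      exact mul_le_of_le_one_right h0.le (abs_planeWave_le n x)
    have hm : AEStronglyMeasurable t volume := (hcont.const_mul ε).aestronglyMeasurable
    have hti := integrable_of_bounded hm habs
    have ht0 : ∫ x, t x = 0 := by rw [integral_const_mul, integral_planeWave hn, mul_zero]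
    have hk := integrable_kernel_of_bounded_right hV hti hm habs
    have hbound (x) : entropyGap (t x) ≤ ε ^ 2 / 2 * planeWave n x ^ 2 + 4 * ε ^ 3 := by
      refine (entropyGap_le ((habs x).trans h1)).trans ?_
      have : |t x| ^ 3 ≤ ε ^ 3 := pow_le_pow_left₀ (abs_nonneg _) (habs x) 3
      have h2 : t x ^ 2 = ε ^ 2 * planeWave n x ^ 2 := mul_pow _ _ _
      rw [h2]
      linarith
    have hlow (x) : -1 ≤ t x := by linarith [(abs_le.mp (habs x)).1]
    have hgapi : Integrable (fun x => entropyGap (t x)) volume := by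
      refine integrable_of_bounded (C := ε ^ 2 / 2 + 4 * ε ^ 3)
        (measurable_entropyGap.comp_aemeasurable hti.aemeasurable).aestronglyMeasurable fun x => ?_
      rw [abs_of_nonneg (entropyGap_nonneg (hlow x))]
      refine (hbound x).trans ?_
      have : planeWave n x ^ 2 ≤ 1 := (sq_le_one_iff_abs_le_one _).mpr (abs_planeWave_le n x)
      nlinarith [sq_nonneg ε]
    have hle := hmin.2 _ (isDensity_perturbed hti ht0 hlow)
    rw [freeEnergy_uniformDensity hV, freeEnergy_perturbed hV hti ht0 hgapi hk,
      EReal.coe_le_coe_iff, le_add_iff_nonneg_right,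
      mul_nonneg_iff_of_pos_left (inv_pos.mpr hN)] at hle
    have hE : energy V t t = ε ^ 2 * ((fourierTransform V n).re * M) := by
      rw [← energy_planeWave hV hs n, energy_eq, energy_eq, ← integral_const_mul]
      congr 1 with p
      simp only [kernel, ht]
      ring
    have hsqi : Integrable (fun x : Torus d L => planeWave n x ^ 2) volume :=
      (MemLp.of_bound (p := 2) hcont.aestronglyMeasurable 1
        (Eventually.of_forall (abs_planeWave_le n))).integrable_sq
    have hS : ∫ x, entropyGap (t x) ≤ ε ^ 2 / 2 * M + 4 * ε ^ 3 * L ^ d := by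
      refine (integral_mono hgapi ((hsqi.const_mul _).add (integrable_const _)) hbound).trans ?_
      rw [integral_add' (hsqi.const_mul _) (integrable_const _), integral_const_mul,
        integral_const, volume_univ_torus, smul_eq_mul]
      linarith
    rw [hE] at hle
    have h3 : 0 ≤ ε ^ 2 / 2 * (M * (1 + θ * (fourierTransform V n).re) + ε * (8 * L ^ d)) := by
      linarith
    exact (mul_nonneg_iff_of_pos_left (by positivity)).mp h3
  have hlim : Tendsto (fun ε : ℝ => M * (1 + θ * (fourierTransform V n).re) + ε * (8 * L ^ d))
      (𝓝[>] 0) (𝓝 (M * (1 + θ * (fourierTransform V n).re) + 0 * (8 * L ^ d))) :=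
    ((tendsto_id.mono_left nhdsWithin_le_nhds).mul_const _).const_add _
  have h := ge_of_tendsto hlim (by
    filter_upwards [Ioc_mem_nhdsGT (show (0 : ℝ) < 1 / 2 by norm_num)] with ε hε
    exact key ε hε.1 hε.2)
  rw [zero_mul, add_zero] at h
  exact (mul_nonneg_iff_of_pos_left hMpos).mp h

end

end McKeanVlasov
end

theorem mainTheorem4 {d : ℕ} {L : ℝ} [Fact (0 < L)]
    (V : McKeanVlasov.Torus d L → ℝ)
    (hV : McKeanVlasov.IsPotentialN V) (hV2 : MemLp V 2 volume)
    (θc : ℝ) (hc : McKeanVlasov.IsLowerCriticalPoint V θc) :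
    McKeanVlasov.IsThetaSharp V θc := by
  have hneg : ∃ n : Fin d → ℤ, n ≠ 0 ∧ (McKeanVlasov.fourierTransform V n).re < 0 := by
    by_contra! h
    -- Without a negative mode `lam` = 0 is admissible, and the bound reads 1 ≤ 0.
    have := McKeanVlasov.one_le_mul_of_isLowerCriticalPoint hV.1 hV2 hc le_rfl (by simpa using h)
    norm_num at this
  obtain ⟨n, hn, hlt⟩ := McKeanVlasov.exists_isMinimizingWaveVector hV2 hneg
  refine ⟨n, hn, hlt, ?_⟩
  have hnorm : ‖McKeanVlasov.fourierTransform V n‖ = -(McKeanVlasov.fourierTransform V n).re := by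
    rw [← abs_of_neg hlt]
    exact (Complex.abs_re_eq_norm.mpr (McKeanVlasov.im_fourierTransform hV.1.symmetric n)).symm
  have h1 := McKeanVlasov.one_le_mul_of_isLowerCriticalPoint hV.1 hV2 hc
    (lam := -(McKeanVlasov.fourierTransform V n).re) (by linarith)
    (fun m hm => by rw [neg_neg]; exact hn.2 m hm)
  have h2 := McKeanVlasov.stability_of_isMinimizer hV.1.integrable hV.1.symmetric
    (hc.unique_below θc hc.nonneg le_rfl).1 hn.1
  rw [hnorm]
  exact eq_inv_of_mul_eq_one_left (by linarith)
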